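/- For $u\in L^2(\mathbb R)$ let $\mathcal W(u,u)$ be its Wigner distribution, the real-valued function on $\mathbb R^2$ given by $$\mathcal W(u,u)(x,\xi)=\int_{\mathbb R} e^{-2i\pi z\xi}\,u\Bigl(x+\frac z2\Bigr)\,\overline{u\Bigl(x-\frac z2\Bigr)}\,dz .$$ (Counterexample to Flandrin's conjecture.) There exists a complex-valued Schwartz function $\phi_0\in\mathscr S(\mathbb R)$ with $\|\phi_0\|_{L^2(\mathbb R)}=1$ such that $$\iint_{x\ge 0,\ \xi\ge 0}\mathcal W(\phi_0,\phi_0)(x,\xi)\,dx\,d\xi>1,$$ and, for the same function $\phi_0$, there exists $a>0$ such that $$\iint_{0\le x\le a,\ 0\le \xi\le a}\mathcal W(\phi_0,\phi_0)(x,\xi)\,dx\,d\xi>1 .$$ -/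

import Mathlib

open MeasureTheory
open scoped SchwartzMap ComplexConjugate

/-- The joint Wigner distribution of two functions `u v : ℝ → ℂ`, as a function on the phase space
`ℝ × ℝ`: `W(u,v)(x,ξ) = ∫ e^{-2iπ z ξ} u(x + z/2) conj (v(x - z/2)) dz`. -/
noncomputable def jointWigner (u v : ℝ → ℂ) (p : ℝ × ℝ) : ℂ :=
  ∫ z : ℝ, Complex.exp (-2 * Complex.I * (Real.pi : ℂ) * (z : ℂ) * (p.2 : ℂ)) *
    u (p.1 + z / 2) * conj (v (p.1 - z / 2))

/-- Hermitian symmetry of the joint Wigner distribution. -/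
theorem conj_jointWigner (u v : ℝ → ℂ) (p : ℝ × ℝ) :
    conj (jointWigner u v p) = jointWigner v u p := by
  unfold jointWigner
  rw [← integral_conj, ← integral_neg_eq_self]
  congr 1
  funext z
  simp only [map_mul, ← Complex.exp_conj, map_neg, Complex.conj_I, Complex.conj_ofReal,
    Complex.conj_conj, Complex.ofReal_neg, map_ofNat]
  rw [show p.1 + -z / 2 = p.1 - z / 2 by ring, show p.1 - -z / 2 = p.1 + z / 2 by ring]
  ring_nf

/-- The Wigner distribution `W(u,u)` of `u`. It is real-valued, see `coe_wigner`, and is therefore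
defined as a real function on the phase space. -/
noncomputable def wigner (u : ℝ → ℂ) (p : ℝ × ℝ) : ℝ :=
  (jointWigner u u p).re

/-- No information is lost by taking the real part in `wigner`. -/
theorem coe_wigner (u : ℝ → ℂ) (p : ℝ × ℝ) :
    (wigner u p : ℂ) = jointWigner u u p :=
  Complex.conj_eq_iff_re.mp (conj_jointWigner u u p)

open Filter Topology Set
open scoped FourierTransform

/-! ### The Wigner distribution of Schwartz functions -/

/-! The counterexample is a sum of two wave packets, `φ = f + g`. Here `f(s) = e^{2πiωs} χ(s)` with
a real bump `χ` supported in `[1,3]`, and `g(s) = κ e^{-2πiωs} χ(-s)` is a small packet on the other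
side of the origin, at the opposite frequency. Let `N = ‖χ‖²`, so that `‖φ‖² = N + κ²N`.

On `x ≥ 0` the distribution `W(g,g)` vanishes. Since `W(f,f)` vanishes for `x < 0`, its integral
over the quarter plane is the `ξ ≥ 0` part of `‖𝓕 f‖²`, namely `N - O(ω⁻³)`, by
`exists_setIntegral_fourier_modulation_le`. The cross term decides the matter. Integrating it over
`ξ ≥ 0` produces the kernel `1/(2πi z)` (`setIntegral_quadrant_jointWigner`). The phases of the two
packets cancel in `z` and leave `e^{4πiωx}`, whose integral over the half line `x ≥ 0` has size only
`1/ω` because of the sharp endpoint. Hence `exists_le_im_integral_packets` yields a gain of at least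
`κ(m/ω - C/ω²)/π` with `m > 0`.

With `κ = k/ω` the gain `km/(πω²)` and the cost `k²N/ω²` in the norm have the same order, all errors
are `O(ω⁻³)`, and a suitable `k` makes the balance positive for large `ω`. Normalizing `φ` and
exhausting the quarter plane by squares finishes the proof. -/

theorem jointWigner_eq_fourier (u v : ℝ → ℂ) (x ξ : ℝ) :
    jointWigner u v (x, ξ) = 𝓕 (fun z : ℝ => u (x + z / 2) * conj (v (x - z / 2))) ξ := by
  rw [Real.fourier_real_eq_integral_exp_smul, jointWigner]
  congr 1
  funext z
  rw [smul_eq_mul, mul_assoc]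
  congr 2
  push_cast
  ring

theorem SchwartzMap.exists_one_add_sq_sq_mul_norm_le (u : 𝓢(ℝ, ℂ)) :
    ∃ A : ℝ, 0 ≤ A ∧ ∀ s, (1 + s ^ 2) ^ 2 * ‖u s‖ ≤ A := by
  obtain ⟨A, hA, h0⟩ := u.decay 0 0
  obtain ⟨B, hB, h2⟩ := u.decay 2 0
  obtain ⟨C, hC, h4⟩ := u.decay 4 0
  refine ⟨A + 2 * B + C, by positivity, fun s => ?_⟩
  have h0 := h0 s
  have h2 := h2 s
  have h4 := h4 s
  simp only [norm_iteratedFDeriv_zero, Real.norm_eq_abs, pow_zero, one_mul] at h0 h2 h4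
  rw [sq_abs] at h2
  rw [show |s| ^ 4 = s ^ 4 by rw [show (4 : ℕ) = 2 * 2 by rfl, pow_mul, sq_abs, pow_mul]] at h4
  linarith

/-- Both `x` and `z` are linear in `s = x + z/2` and `t = x - z/2`, so one factor `(1+s²)(1+t²)`
controls `x` and a second one controls `z`. This is why fourth-order decay of the Schwartz functions
is used. -/
theorem one_add_sq_mul_one_add_sq_le (x z : ℝ) :
    (1 + x ^ 2) * (1 + z ^ 2) ≤
      2 * ((1 + (x + z / 2) ^ 2) ^ 2 * (1 + (x - z / 2) ^ 2) ^ 2) := by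
  set s := x + z / 2 with hs
  set t := x - z / 2 with ht
  have hx : 1 + x ^ 2 ≤ (1 + s ^ 2) * (1 + t ^ 2) := by
    have : x = (s + t) / 2 := by rw [hs, ht]; ring
    rw [this]
    nlinarith [sq_nonneg (s - t), sq_nonneg (s * t), sq_nonneg s, sq_nonneg t]
  have hz : 1 + z ^ 2 ≤ 2 * ((1 + s ^ 2) * (1 + t ^ 2)) := by
    have : z = s - t := by rw [hs, ht]; ring
    rw [this]
    nlinarith [sq_nonneg (s + t), sq_nonneg (s * t), sq_nonneg s, sq_nonneg t]
  calc (1 + x ^ 2) * (1 + z ^ 2)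
      ≤ ((1 + s ^ 2) * (1 + t ^ 2)) * (2 * ((1 + s ^ 2) * (1 + t ^ 2))) := by gcongr
    _ = _ := by ring

theorem exists_norm_mul_conj_le (u v : 𝓢(ℝ, ℂ)) :
    ∃ C : ℝ, 0 ≤ C ∧ ∀ x z : ℝ, ‖u (x + z / 2) * conj (v (x - z / 2))‖ ≤
      C * ((1 + x ^ 2)⁻¹ * (1 + z ^ 2)⁻¹) := by
  obtain ⟨A, hA, hu⟩ := u.exists_one_add_sq_sq_mul_norm_le
  obtain ⟨B, hB, hv⟩ := v.exists_one_add_sq_sq_mul_norm_le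
  refine ⟨2 * (A * B), by positivity, fun x z => ?_⟩
  rw [norm_mul, RCLike.norm_conj, ← mul_inv, ← div_eq_mul_inv, le_div_iff₀ (by positivity)]
  calc ‖u (x + z / 2)‖ * ‖v (x - z / 2)‖ * ((1 + x ^ 2) * (1 + z ^ 2))
      ≤ ‖u (x + z / 2)‖ * ‖v (x - z / 2)‖ *
        (2 * ((1 + (x + z / 2) ^ 2) ^ 2 * (1 + (x - z / 2) ^ 2) ^ 2)) := by
        exact mul_le_mul_of_nonneg_left (one_add_sq_mul_one_add_sq_le x z) (by positivity)
    _ = 2 * (((1 + (x + z / 2) ^ 2) ^ 2 * ‖u (x + z / 2)‖) *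
        ((1 + (x - z / 2) ^ 2) ^ 2 * ‖v (x - z / 2)‖)) := by ring
    _ ≤ 2 * (A * B) := by
        gcongr
        exacts [hu _, hv _]

theorem integrable_inv_one_add_sq_mul :
    Integrable fun p : ℝ × ℝ => (1 + p.1 ^ 2)⁻¹ * (1 + p.2 ^ 2)⁻¹ :=
  integrable_inv_one_add_sq.mul_prod integrable_inv_one_add_sq

theorem integrable_prod_mul_conj (u v : 𝓢(ℝ, ℂ)) :
    Integrable fun p : ℝ × ℝ => u (p.1 + p.2 / 2) * conj (v (p.1 - p.2 / 2)) := by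
  obtain ⟨C, -, h⟩ := exists_norm_mul_conj_le u v
  refine (integrable_inv_one_add_sq_mul.const_mul C).mono' ?_ (ae_of_all _ fun p => h p.1 p.2)
  exact Continuous.aestronglyMeasurable (by fun_prop)

theorem integrable_mul_conj (u v : 𝓢(ℝ, ℂ)) (x : ℝ) :
    Integrable fun z : ℝ => u (x + z / 2) * conj (v (x - z / 2)) := by
  obtain ⟨C, -, h⟩ := exists_norm_mul_conj_le u v
  refine ((integrable_inv_one_add_sq.const_mul (1 + x ^ 2)⁻¹).const_mul C).mono' ?_
    (ae_of_all _ fun z => h x z)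
  exact Continuous.aestronglyMeasurable (by fun_prop)

theorem exists_norm_jointWigner_le_left (u v : 𝓢(ℝ, ℂ)) :
    ∃ C : ℝ, 0 ≤ C ∧ ∀ x ξ : ℝ, ‖jointWigner u v (x, ξ)‖ ≤ C * (1 + x ^ 2)⁻¹ := by
  obtain ⟨C, hC, h⟩ := exists_norm_mul_conj_le u v
  refine ⟨C * Real.pi, by positivity, fun x ξ => ?_⟩
  rw [jointWigner_eq_fourier]
  refine (VectorFourier.norm_fourierIntegral_le_integral_norm _ _ _ _ _).trans ?_
  calc ∫ z, ‖u (x + z / 2) * conj (v (x - z / 2))‖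
      ≤ ∫ z, C * ((1 + x ^ 2)⁻¹ * (1 + z ^ 2)⁻¹) :=
        integral_mono (integrable_mul_conj u v x).norm
          ((integrable_inv_one_add_sq.const_mul _).const_mul _) (h x)
    _ = C * Real.pi * (1 + x ^ 2)⁻¹ := by
        rw [integral_const_mul, integral_const_mul, integral_univ_inv_one_add_sq]
        ring

/-- Integration by parts in `z`; the chain rule on `x ± z/2` gives the factor `1/2` and the relative
sign. -/
theorem jointWigner_frequency_mul (u v : 𝓢(ℝ, ℂ)) (x ξ : ℝ) :
    (2 * Real.pi * Complex.I * ξ) * jointWigner u v (x, ξ) =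
      (jointWigner (SchwartzMap.derivCLM ℂ ℂ u) v (x, ξ) -
        jointWigner u (SchwartzMap.derivCLM ℂ ℂ v) (x, ξ)) / 2 := by
  set u' := SchwartzMap.derivCLM ℂ ℂ u
  set v' := SchwartzMap.derivCLM ℂ ℂ v
  have hd : ∀ z : ℝ, HasDerivAt (fun z : ℝ => u (x + z / 2) * conj (v (x - z / 2)))
      ((u' (x + z / 2) * conj (v (x - z / 2)) - u (x + z / 2) * conj (v' (x - z / 2))) / 2) z := by
    intro z
    have h1 : HasDerivAt (fun z : ℝ => u (x + z / 2)) ((1 / 2 : ℝ) • u' (x + z / 2)) z :=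
      (u.differentiableAt.hasDerivAt (x := x + z / 2)).scomp z
        (((hasDerivAt_id z).div_const 2).const_add x)
    have h2 : HasDerivAt (fun z : ℝ => v (x - z / 2)) ((-(1 / 2) : ℝ) • v' (x - z / 2)) z :=
      (v.differentiableAt.hasDerivAt (x := x - z / 2)).scomp z
        (((hasDerivAt_id z).div_const 2).const_sub x)
    convert! h1.mul h2.star using 1
    simp only [Complex.real_smul, star_mul', RCLike.star_def, Complex.conj_ofReal]
    push_cast
    ring
  have hi1 := integrable_mul_conj u' v x
  have hi2 := integrable_mul_conj u v' x
  have hderiv : deriv (fun z : ℝ => u (x + z / 2) * conj (v (x - z / 2))) = fun z : ℝ =>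
      (u' (x + z / 2) * conj (v (x - z / 2)) - u (x + z / 2) * conj (v' (x - z / 2))) / 2 :=
    funext fun z => (hd z).deriv
  have key := congrFun (Real.fourier_deriv (integrable_mul_conj u v x)
    (fun z => (hd z).differentiableAt) (by rw [hderiv]; exact (hi1.sub hi2).div_const 2)) ξ
  rw [hderiv] at key
  rw [jointWigner_eq_fourier, ← smul_eq_mul, ← key, jointWigner_eq_fourier, jointWigner_eq_fourier]
  simp only [Real.fourier_real_eq]
  rw [← integral_sub, ← integral_div]
  · congr 1
    funext z
    simp only [Circle.smul_def, smul_eq_mul]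
    ring
  · exact (Real.fourierIntegral_convergent_iff' (ContinuousLinearMap.mul ℝ ℝ) ξ).2 hi1
  · exact (Real.fourierIntegral_convergent_iff' (ContinuousLinearMap.mul ℝ ℝ) ξ).2 hi2

/-- Trading `ξ²` for derivatives of `u` and `v` by two uses of `jointWigner_frequency_mul` gives a
bound integrable on the plane, which justifies splitting the integrals and applying Fubini. -/
theorem exists_norm_jointWigner_le (u v : 𝓢(ℝ, ℂ)) :
    ∃ C : ℝ, 0 ≤ C ∧ ∀ x ξ : ℝ, ‖jointWigner u v (x, ξ)‖ ≤
      C * ((1 + x ^ 2)⁻¹ * (1 + ξ ^ 2)⁻¹) := by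
  set u' := SchwartzMap.derivCLM ℂ ℂ u
  set v' := SchwartzMap.derivCLM ℂ ℂ v
  obtain ⟨C₀, h₀, H₀⟩ := exists_norm_jointWigner_le_left u v
  obtain ⟨C₁, h₁, H₁⟩ := exists_norm_jointWigner_le_left (SchwartzMap.derivCLM ℂ ℂ u') v
  obtain ⟨C₂, h₂, H₂⟩ := exists_norm_jointWigner_le_left u' v'
  obtain ⟨C₃, h₃, H₃⟩ := exists_norm_jointWigner_le_left u (SchwartzMap.derivCLM ℂ ℂ v')
  refine ⟨C₀ + (C₁ + C₂ + C₂ + C₃) / 4, by positivity, fun x ξ => ?_⟩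
  have key : (2 * Real.pi * Complex.I * ξ) * ((2 * Real.pi * Complex.I * ξ) *
      jointWigner u v (x, ξ)) = (jointWigner (SchwartzMap.derivCLM ℂ ℂ u') v (x, ξ) -
        jointWigner u' v' (x, ξ) - jointWigner u' v' (x, ξ) +
        jointWigner u (SchwartzMap.derivCLM ℂ ℂ v') (x, ξ)) / 4 := by
    rw [jointWigner_frequency_mul, mul_div_assoc', mul_sub, jointWigner_frequency_mul,
      jointWigner_frequency_mul]
    ring
  have hn := congrArg norm key
  have hpi : ‖(2 * Real.pi * Complex.I * ξ : ℂ)‖ = 2 * Real.pi * |ξ| := by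
    simp [abs_of_pos Real.pi_pos]
  rw [norm_mul, hpi, norm_mul, hpi, norm_div] at hn
  have h4 : ‖(4 : ℂ)‖ = 4 := by norm_num
  rw [h4] at hn
  have htri : ‖jointWigner (SchwartzMap.derivCLM ℂ ℂ u') v (x, ξ) -
        jointWigner u' v' (x, ξ) - jointWigner u' v' (x, ξ) +
        jointWigner u (SchwartzMap.derivCLM ℂ ℂ v') (x, ξ)‖ ≤
        (C₁ + C₂ + C₂ + C₃) * (1 + x ^ 2)⁻¹ := by
    refine ((norm_add_le _ _).trans (add_le_add ((norm_sub_le _ _).trans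
      (add_le_add ((norm_sub_le _ _).trans (add_le_add (H₁ x ξ) (H₂ x ξ))) (H₂ x ξ)))
      (H₃ x ξ))).trans (le_of_eq (by ring))
  set N := ‖jointWigner u v (x, ξ)‖ with hN
  have hN0 : 0 ≤ N := norm_nonneg _
  have hξ : ξ ^ 2 * N ≤ 2 * Real.pi * |ξ| * (2 * Real.pi * |ξ| * N) := by
    have : (1 : ℝ) ≤ (2 * Real.pi) ^ 2 := by nlinarith [Real.pi_gt_three]
    calc ξ ^ 2 * N = 1 * (ξ ^ 2 * N) := by ring
      _ ≤ (2 * Real.pi) ^ 2 * (ξ ^ 2 * N) := by gcongr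
      _ = _ := by rw [← sq_abs ξ]; ring
  rw [← mul_assoc, ← div_eq_mul_inv _ (1 + ξ ^ 2), le_div_iff₀ (by positivity)]
  have := H₀ x ξ
  rw [← hN] at this
  linarith

theorem stronglyMeasurable_jointWigner (u v : 𝓢(ℝ, ℂ)) :
    StronglyMeasurable (jointWigner u v) := by
  unfold jointWigner
  refine StronglyMeasurable.integral_prod_right (f := fun (p : ℝ × ℝ) (z : ℝ) =>
    Complex.exp (-2 * Complex.I * (Real.pi : ℂ) * (z : ℂ) * (p.2 : ℂ)) *
    u (p.1 + z / 2) * conj (v (p.1 - z / 2))) ?_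
  refine Continuous.stronglyMeasurable ?_
  simp only [Function.uncurry_def]
  fun_prop

theorem integrable_jointWigner (u v : 𝓢(ℝ, ℂ)) : Integrable (jointWigner u v) := by
  obtain ⟨C, -, h⟩ := exists_norm_jointWigner_le u v
  exact (integrable_inv_one_add_sq_mul.const_mul C).mono'
    (stronglyMeasurable_jointWigner u v).aestronglyMeasurable (ae_of_all _ fun p => h p.1 p.2)

theorem integrable_jointWigner_right (u v : 𝓢(ℝ, ℂ)) (x : ℝ) :
    Integrable fun ξ => jointWigner u v (x, ξ) := by
  obtain ⟨C, -, h⟩ := exists_norm_jointWigner_le u v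
  exact ((integrable_inv_one_add_sq.const_mul (1 + x ^ 2)⁻¹).const_mul C).mono'
    ((stronglyMeasurable_jointWigner u v).comp_measurable
      measurable_prodMk_left).aestronglyMeasurable (ae_of_all _ fun ξ => h x ξ)

/-- The position marginal of the joint Wigner distribution. -/
theorem integral_jointWigner_left (u v : 𝓢(ℝ, ℂ)) (ξ : ℝ) :
    ∫ x, jointWigner u v (x, ξ) = 𝓕 (u : ℝ → ℂ) ξ * conj (𝓕 (v : ℝ → ℂ) ξ) := by
  set e : ℝ → ℂ := fun z => Complex.exp (↑(-2 * Real.pi * z * ξ) * Complex.I) with he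
  have hec : Continuous e := by rw [he]; fun_prop
  have hen : ∀ z, ‖e z‖ = 1 := fun z => Complex.norm_exp_ofReal_mul_I _
  have hint : Integrable fun p : ℝ × ℝ => e p.2 * (u (p.1 + p.2 / 2) * conj (v (p.1 - p.2 / 2))) :=
    (integrable_prod_mul_conj u v).bdd_mul (c := 1) (by fun_prop)
      (ae_of_all _ fun p => (hen _).le)
  have hshift : ∀ z : ℝ, ∫ x, e z * (u (x + z / 2) * conj (v (x - z / 2))) =
      ∫ t, e z * (u (t + z) * conj (v t)) := fun z => by
    rw [← integral_sub_right_eq_self (fun t => e z * (u (t + z) * conj (v t))) (z / 2)]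
    congr 1
    funext x
    rw [show x - z / 2 + z = x + z / 2 by ring]
  -- With `t = x - z/2` and `s = x + z/2` one has `z = s - t`, so the character splits and the
  -- double integral factors.
  have hexp : ∀ t s : ℝ, e (s - t) = e s * conj (e t) := fun t s => by
    simp only [he, ← Complex.exp_conj, map_mul, Complex.conj_ofReal, Complex.conj_I]
    rw [← Complex.exp_add]
    congr 1
    push_cast
    ring
  have hu : Integrable fun s => e s * u s :=
    u.integrable.bdd_mul (c := 1) hec.aestronglyMeasurable (ae_of_all _ fun p => (hen _).le)
  have hv : Integrable fun t => conj (e t * v t) :=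
    Complex.conjLIE.integrable_comp_iff.2 (v.integrable.bdd_mul (c := 1) hec.aestronglyMeasurable
      (ae_of_all _ fun p => (hen _).le))
  have hint' : Integrable fun p : ℝ × ℝ => e p.2 * (u (p.1 + p.2) * conj (v p.1)) := by
    have h := (measurePreserving_prod_add (volume : Measure ℝ) volume).integrable_comp_of_integrable
      (hv.mul_prod hu)
    refine h.congr (ae_of_all _ fun p => ?_)
    have := hexp p.1 (p.1 + p.2)
    rw [add_sub_cancel_left] at this
    simp only [Function.comp, this, map_mul]
    ring
  have hW : ∀ x, jointWigner u v (x, ξ) = ∫ z, e z * (u (x + z / 2) * conj (v (x - z / 2))) :=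
    fun x => by
      rw [jointWigner_eq_fourier, Real.fourier_real_eq_integral_exp_smul]
      rfl
  calc ∫ x, jointWigner u v (x, ξ)
      = ∫ x, ∫ z, e z * (u (x + z / 2) * conj (v (x - z / 2))) := by simp_rw [hW]
    _ = ∫ z, ∫ x, e z * (u (x + z / 2) * conj (v (x - z / 2))) := integral_integral_swap hint
    _ = ∫ z, ∫ t, e z * (u (t + z) * conj (v t)) := by simp_rw [hshift]
    _ = ∫ t, ∫ z, e z * (u (t + z) * conj (v t)) := (integral_integral_swap hint').symm
    _ = ∫ t, ∫ s, (e s * u s) * conj (e t * v t) := by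
        congr 1
        funext t
        rw [← integral_add_left_eq_self (fun s => (e s * u s) * conj (e t * v t)) t]
        congr 1
        funext z
        have := hexp t (t + z)
        rw [add_sub_cancel_left] at this
        rw [this, map_mul]
        ring
    _ = 𝓕 (u : ℝ → ℂ) ξ * conj (𝓕 (v : ℝ → ℂ) ξ) := by
        simp_rw [integral_mul_const]
        rw [integral_const_mul, integral_conj, Real.fourier_real_eq_integral_exp_smul,
          Real.fourier_real_eq_integral_exp_smul]
        rfl

/-! ### Integrals of Wigner distributions over the quarter plane -/

theorem jointWigner_add_left (u₁ u₂ v : 𝓢(ℝ, ℂ)) (p : ℝ × ℝ) :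
    jointWigner (u₁ + u₂) v p = jointWigner u₁ v p + jointWigner u₂ v p := by
  obtain ⟨x, ξ⟩ := p
  simp only [jointWigner_eq_fourier, Real.fourier_real_eq]
  rw [← integral_add]
  · congr 1
    funext z
    simp only [Pi.add_apply, Circle.smul_def, smul_eq_mul]
    ring
  · exact (Real.fourierIntegral_convergent_iff' (ContinuousLinearMap.mul ℝ ℝ) ξ).2
      (integrable_mul_conj u₁ v x)
  · exact (Real.fourierIntegral_convergent_iff' (ContinuousLinearMap.mul ℝ ℝ) ξ).2
      (integrable_mul_conj u₂ v x)

theorem jointWigner_add_right (u v₁ v₂ : 𝓢(ℝ, ℂ)) (p : ℝ × ℝ) :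
    jointWigner u (v₁ + v₂) p = jointWigner u v₁ p + jointWigner u v₂ p := by
  rw [← conj_jointWigner, jointWigner_add_left, map_add, conj_jointWigner, conj_jointWigner]

theorem wigner_add (u v : 𝓢(ℝ, ℂ)) (p : ℝ × ℝ) :
    wigner (u + v) p = wigner u p + 2 * (jointWigner u v p).re + wigner v p := by
  have h := jointWigner_add_left u v (u + v) p
  have h1 := jointWigner_add_right u u v p
  have h2 := jointWigner_add_right v u v p
  have h3 : (jointWigner v u p).re = (jointWigner u v p).re := by
    rw [← conj_jointWigner, Complex.conj_re]
  simp only [FunLike.coe_add] at h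
  rw [wigner, h, h1, h2]
  simp only [Complex.add_re, h3, wigner]
  ring

theorem wigner_smul (c : ℂ) (u : ℝ → ℂ) (p : ℝ × ℝ) :
    wigner (c • u) p = ‖c‖ ^ 2 * wigner u p := by
  have : jointWigner (c • u) (c • u) p = ((‖c‖ ^ 2 : ℝ) : ℂ) * jointWigner u u p := by
    rw [jointWigner, jointWigner, ← integral_const_mul]
    congr 1
    funext z
    rw [← Complex.normSq_eq_norm_sq, Complex.normSq_eq_conj_mul_self]
    simp only [Pi.smul_apply, smul_eq_mul, map_mul]
    ring
  rw [wigner, this, Complex.re_ofReal_mul, wigner]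

theorem integrable_wigner (u : 𝓢(ℝ, ℂ)) : Integrable (wigner u) :=
  (integrable_jointWigner u u).re

/-- The midpoint of `x + z/2` and `x - z/2` is `x`, so one of them is always nonpositive. -/
theorem jointWigner_eq_zero_of_neg {u : ℝ → ℂ} (hu : ∀ s ≤ 0, u s = 0) {x : ℝ} (hx : x < 0)
    (ξ : ℝ) : jointWigner u u (x, ξ) = 0 := by
  rw [jointWigner]
  refine (integral_congr_ae (ae_of_all _ fun z => ?_)).trans (integral_zero _ _)
  rcases le_total z 0 with hz | hz
  · simp [hu (x + z / 2) (by linarith)]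
  · simp [hu (x - z / 2) (by linarith)]

theorem jointWigner_eq_zero_of_nonneg {u : ℝ → ℂ} (hu : ∀ s, 0 ≤ s → u s = 0) {x : ℝ}
    (hx : 0 ≤ x) (ξ : ℝ) : jointWigner u u (x, ξ) = 0 := by
  rw [jointWigner]
  refine (integral_congr_ae (ae_of_all _ fun z => ?_)).trans (integral_zero _ _)
  rcases le_total 0 z with hz | hz
  · simp [hu (x + z / 2) (by linarith)]
  · simp [hu (x - z / 2) (by linarith)]

theorem setOf_quadrant_eq_prod :
    {p : ℝ × ℝ | 0 ≤ p.1 ∧ 0 ≤ p.2} = Ici 0 ×ˢ Ici 0 := rfl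

/-- The cutoff in `x` is invisible to such an `f`, so the quarter plane may be replaced by a half
plane and the marginal formula applies. -/
theorem setIntegral_quadrant_jointWigner_self (f : 𝓢(ℝ, ℂ)) (hf : ∀ s ≤ 0, f s = 0) :
    ∫ p in {p : ℝ × ℝ | 0 ≤ p.1 ∧ 0 ≤ p.2}, jointWigner f f p =
      ((∫ ξ in Ici 0, ‖𝓕 (f : ℝ → ℂ) ξ‖ ^ 2 : ℝ) : ℂ) := by
  have h1 : ∫ p in Ici (0 : ℝ) ×ˢ Ici (0 : ℝ), jointWigner f f p =
      ∫ p in univ ×ˢ Ici (0 : ℝ), jointWigner f f p := by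
    refine (setIntegral_eq_of_subset_of_forall_sdiff_eq_zero
      (MeasurableSet.univ.prod measurableSet_Ici) (prod_mono_left (subset_univ _)) ?_).symm
    rintro ⟨x, ξ⟩ ⟨⟨-, h2⟩, h3⟩
    exact jointWigner_eq_zero_of_neg hf (not_le.1 fun h => h3 ⟨h, h2⟩) ξ
  rw [setOf_quadrant_eq_prod, h1, Measure.volume_eq_prod, ← Measure.prod_restrict,
    Measure.restrict_univ, integral_prod_symm, ← integral_complex_ofReal]
  · congr 1
    funext ξ
    rw [integral_jointWigner_left, Complex.mul_conj, Complex.normSq_eq_norm_sq]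
  · have := (integrable_jointWigner f f).integrableOn (s := univ ×ˢ Ici (0 : ℝ))
    rwa [IntegrableOn, Measure.volume_eq_prod, ← Measure.prod_restrict,
      Measure.restrict_univ] at this

theorem setIntegral_quadrant_wigner_add (f g : 𝓢(ℝ, ℂ)) (hf : ∀ s ≤ 0, f s = 0)
    (hg : ∀ s, 0 ≤ s → g s = 0) :
    ∫ p in {p : ℝ × ℝ | 0 ≤ p.1 ∧ 0 ≤ p.2}, wigner (f + g) p =
      (∫ ξ in Ici 0, ‖𝓕 (f : ℝ → ℂ) ξ‖ ^ 2) +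
      2 * (∫ p in {p : ℝ × ℝ | 0 ≤ p.1 ∧ 0 ≤ p.2}, jointWigner f g p).re := by
  have hQ : MeasurableSet {p : ℝ × ℝ | 0 ≤ p.1 ∧ 0 ≤ p.2} := by
    rw [setOf_quadrant_eq_prod]
    exact measurableSet_Ici.prod measurableSet_Ici
  have h1 : ∫ p in {p : ℝ × ℝ | 0 ≤ p.1 ∧ 0 ≤ p.2}, wigner (f + g) p =
      ∫ p in {p : ℝ × ℝ | 0 ≤ p.1 ∧ 0 ≤ p.2}, (wigner f p + 2 * (jointWigner f g p).re) := by
    refine setIntegral_congr_fun hQ ?_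
    rintro ⟨x, ξ⟩ ⟨hx, -⟩
    rw [wigner_add, wigner.eq_def g, jointWigner_eq_zero_of_nonneg hg hx]
    simp
  have hre : Integrable fun p => (jointWigner f g p).re := (integrable_jointWigner f g).re
  rw [h1, integral_add (integrable_wigner f).integrableOn
    (hre.const_mul 2).integrableOn, integral_const_mul]
  congr 1
  · have := setIntegral_quadrant_jointWigner_self f hf
    have h2 := congrArg Complex.re this
    rw [Complex.ofReal_re] at h2
    rw [← h2]
    exact integral_re (integrable_jointWigner f f).integrableOn
  · exact congrArg (2 * ·) (integral_re (integrable_jointWigner f g).integrableOn)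

/-- Up to the factor `-2πi`, `𝓕 G` is the derivative of `𝓕 (G/z)`, which tends to zero by
Riemann–Lebesgue. The gap around `z = 0` keeps `G/z` integrable, so no principal value appears. -/
theorem integral_Ici_fourier {G : ℝ → ℂ} (hG : Integrable G) (hG0 : ∀ z < 1, G z = 0)
    (hF : Integrable (𝓕 G)) :
    ∫ ξ in Ici 0, 𝓕 G ξ = (2 * Real.pi * Complex.I)⁻¹ * ∫ z, G z / z := by
  set H : ℝ → ℂ := fun z => G z / z
  have hzH : (fun z : ℝ => z • H z) = G := by
    funext z
    rcases lt_or_ge z 1 with hz | hz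
    · simp [H, hG0 z hz]
    · have : (z : ℂ) ≠ 0 := by exact_mod_cast (by linarith : z ≠ 0)
      simp only [H, Complex.real_smul]
      field_simp
  have hH : Integrable H := by
    refine hG.mono (hG.aestronglyMeasurable.mul
      (Complex.measurable_ofReal.inv.aestronglyMeasurable)) (ae_of_all _ fun z => ?_)
    rcases lt_or_ge z 1 with hz | hz
    · simp [H, hG0 z hz]
    · simp only [H, norm_div, Complex.norm_real, Real.norm_eq_abs]
      exact div_le_self (norm_nonneg _) (hz.trans (le_abs_self z))
  have hderiv : ∀ ξ, HasDerivAt (𝓕 H) ((-2 * Real.pi * Complex.I) * 𝓕 G ξ) ξ := fun ξ => by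
    convert! Real.hasDerivAt_fourier hH (by rwa [hzH]) ξ using 1
    rw [Real.fourier_real_eq, Real.fourier_real_eq, ← integral_const_mul]
    congr 1
    funext z
    rw [← congrFun hzH z]
    simp only [Circle.smul_def, smul_eq_mul, Complex.real_smul]
    ring
  have hlim : Tendsto (𝓕 H) atTop (𝓝 0) :=
    (Real.zero_at_infty_fourier H).mono_left atTop_le_cocompact
  have key := integral_Ioi_of_hasDerivAt_of_tendsto' (a := 0) (fun ξ _ => hderiv ξ)
    (hF.const_mul _).integrableOn hlim
  have h0 : 𝓕 H 0 = ∫ z, H z := by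
    rw [Real.fourier_real_eq]
    simp
  rw [integral_const_mul, h0] at key
  have hne : (2 * Real.pi * Complex.I : ℂ) ≠ 0 := Complex.two_pi_I_ne_zero
  rw [integral_Ici_eq_integral_Ioi, eq_inv_mul_iff_mul_eq₀ hne]
  linear_combination -key

theorem setIntegral_quadrant_jointWigner (f g : 𝓢(ℝ, ℂ)) (hf : ∀ s < 1, f s = 0)
    (hg : ∀ s > -1, g s = 0) :
    ∫ p in {p : ℝ × ℝ | 0 ≤ p.1 ∧ 0 ≤ p.2}, jointWigner f g p =
      (2 * Real.pi * Complex.I)⁻¹ *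
        ∫ x in Ici (0 : ℝ), ∫ z, f (x + z / 2) * conj (g (x - z / 2)) / z := by
  rw [setOf_quadrant_eq_prod, Measure.volume_eq_prod, setIntegral_prod, ← integral_const_mul]
  · congr 1
    funext x
    have hF : (fun ξ => jointWigner f g (x, ξ)) =
        𝓕 (fun z : ℝ => f (x + z / 2) * conj (g (x - z / 2))) :=
      funext fun ξ => jointWigner_eq_fourier _ _ _ _
    rw [← integral_Ici_fourier (integrable_mul_conj f g x) ?_ ?_, ← hF]
    · intro z hz
      rcases le_total x 0 with hx | hx
      · simp [hf (x + z / 2) (by linarith)]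
      · simp [hg (x - z / 2) (by linarith)]
    · rw [← hF]
      exact integrable_jointWigner_right f g x
  · rw [← Measure.volume_eq_prod]
    exact (integrable_jointWigner f g).integrableOn

/-! ### Asymptotics of the interaction of two wave packets -/

/-- A one-sided oscillatory integral is governed by the value at its endpoint. -/
theorem le_integral_sin_mul {p p' p'' : ℝ → ℝ} {a b B : ℝ} (ha : 0 < a) (hb : 0 ≤ b)
    (hp : ∀ x, HasDerivAt p (p' x) x) (hp' : ∀ x, HasDerivAt p' (p'' x) x)
    (hc : Continuous p'') (hpb : p b = 0) (hpb' : p' b = 0) (hB : ∀ x, |p'' x| ≤ B) :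
    p 0 / a - b * B / a ^ 2 ≤ ∫ x in (0 : ℝ)..b, Real.sin (a * x) * p x := by
  have hpc : Continuous p := continuous_iff_continuousAt.2 fun x => (hp x).continuousAt
  -- Two integrations by parts, written as an explicit primitive. Its value at `b` vanishes with `p
  -- b` and `p' b`; at `0` the sine kills the second term and only `p 0 / a` survives.
  have hd : ∀ x, HasDerivAt (fun x => -Real.cos (a * x) * p x / a + Real.sin (a * x) * p' x / a ^ 2)
      (Real.sin (a * x) * p x + Real.sin (a * x) * p'' x / a ^ 2) x := fun x => by
    have hax : HasDerivAt (fun x => a * x) a x := by simpa using (hasDerivAt_id x).const_mul a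
    convert! ((hax.cos.neg.mul (hp x)).div_const a).add ((hax.sin.mul (hp' x)).div_const (a ^ 2))
      using 1
    field_simp
    simp only [Pi.neg_apply]
    ring
  have h1 : IntervalIntegrable (fun x => Real.sin (a * x) * p x) volume 0 b :=
    Continuous.intervalIntegrable (by fun_prop) _ _
  have h2 : IntervalIntegrable (fun x => Real.sin (a * x) * p'' x / a ^ 2) volume 0 b :=
    Continuous.intervalIntegrable (by fun_prop) _ _
  have key := intervalIntegral.integral_eq_sub_of_hasDerivAt (fun x _ => hd x) (h1.add h2)
  rw [intervalIntegral.integral_add h1 h2, hpb, hpb'] at key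
  have hbound : ‖∫ x in (0 : ℝ)..b, Real.sin (a * x) * p'' x / a ^ 2‖ ≤ B / a ^ 2 * |b - 0| := by
    refine intervalIntegral.norm_integral_le_of_norm_le_const fun x _ => ?_
    rw [norm_div, norm_mul, Real.norm_eq_abs, Real.norm_eq_abs, Real.norm_eq_abs,
      abs_of_pos (a := a ^ 2) (by positivity)]
    gcongr
    calc |Real.sin (a * x)| * |p'' x| ≤ 1 * |p'' x| := by
          gcongr
          exact Real.abs_sin_le_one _
      _ ≤ B := by rw [one_mul]; exact hB x
  rw [sub_zero, abs_of_nonneg hb, Real.norm_eq_abs] at hbound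
  have h3 := (abs_le.1 hbound).2
  simp only [mul_zero, zero_div, add_zero, Real.cos_zero, Real.sin_zero, zero_mul, neg_mul,
    one_mul] at key
  have h4 : B / a ^ 2 * b = b * B / a ^ 2 := by ring
  have h5 : -p 0 / a = -(p 0 / a) := by ring
  rw [h4] at h3
  rw [h5] at key
  linarith

theorem integrable_prod_mul_conj_div (f g : 𝓢(ℝ, ℂ)) (hf : ∀ s < 1, f s = 0)
    (hg : ∀ s > -1, g s = 0) :
    Integrable fun p : ℝ × ℝ => f (p.1 + p.2 / 2) * conj (g (p.1 - p.2 / 2)) / p.2 := by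
  refine (integrable_prod_mul_conj f g).mono ?_ (ae_of_all _ fun p => ?_)
  · exact (integrable_prod_mul_conj f g).aestronglyMeasurable.mul
      (Complex.measurable_ofReal.comp measurable_snd).inv.aestronglyMeasurable
  · rw [norm_div, Complex.norm_real, Real.norm_eq_abs]
    rcases lt_or_ge p.2 1 with hz | hz
    · have : f (p.1 + p.2 / 2) * conj (g (p.1 - p.2 / 2)) = 0 := by
        rcases le_total p.1 0 with hx | hx
        · simp [hf (p.1 + p.2 / 2) (by linarith)]
        · simp [hg (p.1 - p.2 / 2) (by linarith)]
      simp [this]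
    · exact div_le_self (norm_nonneg _) (hz.trans (le_abs_self _))

/-- For each `z` the integral in `x` is a one-sided sine integral with endpoint value `χ(z/2)²`,
hence the positive main term. The constants are independent of `ω` and `κ`, which allows `κ` to be
chosen later in terms of `ω`. -/
theorem exists_le_im_integral_packets {χ : ℝ → ℝ} (hχ : ContDiff ℝ 2 χ)
    (hsupp : tsupport χ ⊆ Icc 1 3) (hχ0 : χ 2 ≠ 0) :
    ∃ m C : ℝ, 0 < m ∧ 0 ≤ C ∧ ∀ (ω κ : ℝ) (f g : 𝓢(ℝ, ℂ)), 0 < ω → 0 ≤ κ →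
      (∀ s : ℝ, f s = Complex.exp (↑(2 * Real.pi * ω * s) * Complex.I) * χ s) →
      (∀ s : ℝ, g s = κ * Complex.exp (↑(-(2 * Real.pi * ω * s)) * Complex.I) * χ (-s)) →
      κ * (m / ω - C / ω ^ 2) ≤
        (∫ x in Ici (0 : ℝ), ∫ z, f (x + z / 2) * conj (g (x - z / 2)) / z).im := by
  have hz0 : ∀ s, s ∉ Icc (1 : ℝ) 3 → χ s = 0 := fun s hs =>
    image_eq_zero_of_notMem_tsupport fun h => hs (hsupp h)
  have hd0 : ∀ s, s ∉ Icc (1 : ℝ) 3 → deriv χ s = 0 := fun s hs => by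
    by_contra h
    exact hs (hsupp (support_deriv_subset h))
  have hc : Continuous χ := hχ.continuous
  have hχ1 : ContDiff ℝ 1 (deriv χ) := (contDiff_succ_iff_deriv (n := 1)).1 hχ |>.2.2
  have hc1 : Continuous (deriv χ) := hχ1.continuous
  have hc2 : Continuous (deriv (deriv χ)) := hχ1.continuous_deriv le_rfl
  have hcs : HasCompactSupport χ := HasCompactSupport.intro isCompact_Icc hz0
  have hder : ∀ s, HasDerivAt χ (deriv χ s) s := fun s =>
    (hχ.differentiable (by norm_num) s).hasDerivAt
  have hder1 : ∀ s, HasDerivAt (deriv χ) (deriv (deriv χ) s) s := fun s =>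
    (hχ1.differentiable (by norm_num) s).hasDerivAt
  obtain ⟨B₀, hB₀⟩ := hc.bounded_above_of_compact_support hcs
  obtain ⟨B₁, hB₁⟩ := hc1.bounded_above_of_compact_support hcs.deriv
  obtain ⟨B₂, hB₂⟩ := hc2.bounded_above_of_compact_support hcs.deriv.deriv
  simp only [Real.norm_eq_abs] at hB₀ hB₁ hB₂
  have hB₀' : 0 ≤ B₀ := (abs_nonneg _).trans (hB₀ 0)
  have hB₁' : 0 ≤ B₁ := (abs_nonneg _).trans (hB₁ 0)
  have hB₂' : 0 ≤ B₂ := (abs_nonneg _).trans (hB₂ 0)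
  set B := B₂ * B₀ + 2 * (B₁ * B₁) + B₀ * B₂
  have hB : 0 ≤ B := by positivity
  set M : ℝ → ℝ := fun z => χ (z / 2) ^ 2 / z
  have hMi : Integrable M := by
    have hbase : Integrable fun z => χ (z / 2) ^ 2 := by
      refine Continuous.integrable_of_hasCompactSupport (by fun_prop) ?_
      refine HasCompactSupport.intro (isCompact_Icc (a := (2 : ℝ)) (b := 6)) fun z hz => ?_
      rw [hz0 (z / 2) fun h => hz ⟨by linarith [h.1], by linarith [h.2]⟩]
      simp
    refine hbase.mono (hbase.aestronglyMeasurable.mul measurable_inv.aestronglyMeasurable)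
      (ae_of_all _ fun z => ?_)
    rw [norm_div]
    rcases lt_or_ge z 1 with hz | hz
    · simp [hz0 (z / 2) fun h => by linarith [h.1]]
    · exact div_le_self (norm_nonneg _) (hz.trans (le_abs_self _))
  have hM0 : ∀ z, 0 ≤ M z := fun z => by
    rcases le_total z 0 with hz | hz
    · simp [M, hz0 (z / 2) fun h => by linarith [h.1]]
    · simp only [M]; positivity
  have hMpos : 0 < ∫ z, M z := by
    rw [integral_pos_iff_support_of_nonneg hM0 hMi]
    have hopen : IsOpen {z : ℝ | χ (z / 2) ≠ 0} := isOpen_ne_fun (by fun_prop) (by fun_prop)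
    have hsub : {z : ℝ | χ (z / 2) ≠ 0} ⊆ Function.support M := fun z hz => by
      have : z ≠ 0 := fun h => hz (by rw [h]; exact hz0 _ fun h => by norm_num at h)
      exact div_ne_zero (pow_ne_zero _ hz) this
    refine (hopen.measure_pos volume ⟨4, ?_⟩).trans_le (measure_mono hsub)
    rw [mem_ofPred_eq, show (4 : ℝ) / 2 = 2 by norm_num]
    exact hχ0
  -- The oscillation has frequency `a = 4πω`. In the error, `4` is the length of the `z`-interval
  -- `[2,6]` and `3` the length of the `x`-interval `[0,3]`.
  refine ⟨(∫ z, M z) / (4 * Real.pi), 4 * (3 * B) / (4 * Real.pi) ^ 2, by positivity,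
    by positivity, fun ω κ f g hω hκ hf hg => ?_⟩
  set a := 4 * Real.pi * ω with hadef
  have ha : 0 < a := by positivity
  have hf0 : ∀ s < 1, f s = 0 := fun s hs => by
    rw [hf, hz0 s fun h => by linarith [h.1]]
    simp
  have hg0 : ∀ s > -1, g s = 0 := fun s hs => by
    rw [hg, hz0 (-s) fun h => by linarith [h.1]]
    simp
  have hprod : ∀ x z : ℝ, f (x + z / 2) * conj (g (x - z / 2)) / z =
      ((κ / z * (χ (z / 2 + x) * χ (z / 2 - x)) : ℝ) : ℂ) *
        Complex.exp (↑(a * x) * Complex.I) := fun x z => by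
    rw [hf, hg, show -(x - z / 2) = z / 2 - x by ring, add_comm x (z / 2)]
    simp only [map_mul, Complex.conj_ofReal, ← Complex.exp_conj, Complex.conj_I]
    have : Complex.exp (↑(a * x) * Complex.I) =
        Complex.exp (↑(2 * Real.pi * ω * (z / 2 + x)) * Complex.I) *
        Complex.exp (↑(-(2 * Real.pi * ω * (x - z / 2))) * -Complex.I) := by
      rw [← Complex.exp_add, hadef]
      congr 1
      push_cast
      ring
    rw [this]
    push_cast
    ring
  have him : ∀ x z : ℝ, (f (x + z / 2) * conj (g (x - z / 2)) / z).im =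
      κ / z * (Real.sin (a * x) * (χ (z / 2 + x) * χ (z / 2 - x))) := fun x z => by
    rw [hprod, Complex.im_ofReal_mul, Complex.exp_ofReal_mul_I_im]
    ring
  have hint : Integrable (fun p : ℝ × ℝ => f (p.1 + p.2 / 2) * conj (g (p.1 - p.2 / 2)) / p.2)
      ((volume.restrict (Ici 0)).prod volume) := by
    have := (integrable_prod_mul_conj_div f g hf0 hg0).integrableOn (s := Ici (0 : ℝ) ×ˢ univ)
    rwa [IntegrableOn, Measure.volume_eq_prod, ← Measure.prod_restrict,
      Measure.restrict_univ] at this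
  have hinner : ∀ z : ℝ, Integrable (fun x => f (x + z / 2) * conj (g (x - z / 2)) / z)
      (volume.restrict (Ici 0)) := fun z => by
    refine Integrable.integrableOn ?_
    refine Integrable.div_const ?_ _
    refine Continuous.integrable_of_hasCompactSupport (by fun_prop) ?_
    refine HasCompactSupport.intro (isCompact_Icc (a := 1 - z / 2) (b := 3 - z / 2)) fun x hx => ?_
    rw [hf, hz0 (x + z / 2) fun h => hx ⟨by linarith [h.1], by linarith [h.2]⟩]
    simp
  rw [integral_integral_swap hint]
  have hswap : (∫ z, ∫ x in Ici (0 : ℝ), f (x + z / 2) * conj (g (x - z / 2)) / z).im =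
      ∫ z, (∫ x in Ici (0 : ℝ), f (x + z / 2) * conj (g (x - z / 2)) / z).im :=
    (integral_im hint.integral_prod_right).symm
  have hlow : ∀ z, κ * (M z / a - (Icc (2 : ℝ) 6).indicator (fun _ => 3 * B / a ^ 2) z) ≤
      (∫ x in Ici (0 : ℝ), f (x + z / 2) * conj (g (x - z / 2)) / z).im := fun z => by
    have hre : (∫ x in Ici (0 : ℝ), f (x + z / 2) * conj (g (x - z / 2)) / z).im =
        κ / z * ∫ x in Ici (0 : ℝ), Real.sin (a * x) * (χ (z / 2 + x) * χ (z / 2 - x)) := by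
      rw [← integral_const_mul]
      simp_rw [← him]
      exact (integral_im (hinner z)).symm
    rw [hre]
    by_cases hz : z ∈ Icc (2 : ℝ) 6
    · have hsplit : ∫ x in Ici (0 : ℝ), Real.sin (a * x) * (χ (z / 2 + x) * χ (z / 2 - x)) =
          ∫ x in (0 : ℝ)..3, Real.sin (a * x) * (χ (z / 2 + x) * χ (z / 2 - x)) := by
        rw [integral_Ici_eq_integral_Ioi, intervalIntegral.integral_of_le (by norm_num)]
        refine setIntegral_eq_of_subset_of_forall_sdiff_eq_zero measurableSet_Ioi
          (fun x hx => hx.1) ?_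
        rintro x ⟨hx, hx'⟩
        have : 3 < x := not_le.1 fun h => hx' ⟨hx, h⟩
        rw [hz0 (z / 2 + x) fun h => by linarith [h.2, hz.1]]
        simp
      have key := le_integral_sin_mul (p := fun x => χ (z / 2 + x) * χ (z / 2 - x))
        (p' := fun x => deriv χ (z / 2 + x) * χ (z / 2 - x) - χ (z / 2 + x) * deriv χ (z / 2 - x))
        (p'' := fun x => deriv (deriv χ) (z / 2 + x) * χ (z / 2 - x) -
          2 * (deriv χ (z / 2 + x) * deriv χ (z / 2 - x)) +
          χ (z / 2 + x) * deriv (deriv χ) (z / 2 - x)) (a := a) (b := 3) (B := B) ha (by norm_num)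
        (fun x => ?_) (fun x => ?_) (by fun_prop) ?_ ?_ (fun x => ?_)
      · rw [hsplit, indicator_of_mem hz]
        have hz1 : 0 < z := by linarith [hz.1]
        have hzi : z⁻¹ ≤ 1 := inv_le_one_of_one_le₀ (by linarith [hz.1])
        have hnn : 0 ≤ 3 * B / a ^ 2 := by positivity
        -- `M z` already carries its factor `1/z`; in the error term that factor is at most one and
        -- is dropped.
        calc κ * (M z / a - 3 * B / a ^ 2)
            ≤ κ * (M z / a - z⁻¹ * (3 * B / a ^ 2)) := by
              gcongr
              exact mul_le_of_le_one_left hnn hzi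
          _ = κ / z * (χ (z / 2 + 0) * χ (z / 2 - 0) / a - 3 * B / a ^ 2) := by
              simp only [M, add_zero, sub_zero]
              ring
          _ ≤ _ := by gcongr
      · have h1 := (hder (z / 2 + x)).comp x ((hasDerivAt_id x).const_add (z / 2))
        have h2 := (hder (z / 2 - x)).comp x ((hasDerivAt_id x).const_sub (z / 2))
        convert! h1.mul h2 using 1
        simp only [Function.comp]
        simp
        ring
      · have h1 := (hder (z / 2 + x)).comp x ((hasDerivAt_id x).const_add (z / 2))
        have h2 := (hder (z / 2 - x)).comp x ((hasDerivAt_id x).const_sub (z / 2))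
        have h3 := (hder1 (z / 2 + x)).comp x ((hasDerivAt_id x).const_add (z / 2))
        have h4 := (hder1 (z / 2 - x)).comp x ((hasDerivAt_id x).const_sub (z / 2))
        convert! (h3.mul h2).sub (h1.mul h4) using 1
        simp only [Function.comp]
        simp
        ring
      · rw [hz0 (z / 2 + 3) fun h => by linarith [h.2, hz.1], zero_mul]
      · rw [hz0 (z / 2 + 3) fun h => by linarith [h.2, hz.1],
          hd0 (z / 2 + 3) fun h => by linarith [h.2, hz.1]]
        ring
      · have e1 : |deriv (deriv χ) (z / 2 + x) * χ (z / 2 - x)| ≤ B₂ * B₀ := by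
          rw [abs_mul]
          exact mul_le_mul (hB₂ _) (hB₀ _) (abs_nonneg _) hB₂'
        have e2 : |deriv χ (z / 2 + x) * deriv χ (z / 2 - x)| ≤ B₁ * B₁ := by
          rw [abs_mul]
          exact mul_le_mul (hB₁ _) (hB₁ _) (abs_nonneg _) hB₁'
        have e3 : |χ (z / 2 + x) * deriv (deriv χ) (z / 2 - x)| ≤ B₀ * B₂ := by
          rw [abs_mul]
          exact mul_le_mul (hB₀ _) (hB₂ _) (abs_nonneg _) hB₀'
        rw [abs_le] at e1 e2 e3 ⊢
        constructor <;> linarith [e1.1, e1.2, e2.1, e2.2, e3.1, e3.2]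
    · have hvan : ∀ x, χ (z / 2 + x) * χ (z / 2 - x) = 0 := fun x => by
        by_contra h
        have h1 : z / 2 + x ∈ Icc (1 : ℝ) 3 := by
          by_contra h'
          exact h (by rw [hz0 _ h', zero_mul])
        have h2 : z / 2 - x ∈ Icc (1 : ℝ) 3 := by
          by_contra h'
          exact h (by rw [hz0 _ h', mul_zero])
        exact hz ⟨by linarith [h1.1, h2.1], by linarith [h1.2, h2.2]⟩
      have hMz : M z = 0 := by
        have := hvan 0
        simp only [add_zero, sub_zero] at this
        simp only [M, sq, this, zero_div]
      rw [indicator_of_notMem hz, hMz]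
      simp [hvan]
  have hindi : Integrable ((Icc (2 : ℝ) 6).indicator fun _ => 3 * B / a ^ 2) := by
    rw [integrable_indicator_iff measurableSet_Icc]
    exact integrableOn_const (by simp)
  calc κ * ((∫ z, M z) / (4 * Real.pi) / ω - 4 * (3 * B) / (4 * Real.pi) ^ 2 / ω ^ 2)
      = ∫ z, κ * (M z / a - (Icc (2 : ℝ) 6).indicator (fun _ => 3 * B / a ^ 2) z) := by
        rw [integral_const_mul, integral_sub (hMi.div_const a) hindi, integral_div,
          integral_indicator measurableSet_Icc, setIntegral_const]
        have hvol : volume.real (Icc (2 : ℝ) 6) = 4 := by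
          rw [Real.volume_real_Icc_of_le (by norm_num)]
          norm_num
        rw [hvol, hadef, smul_eq_mul]
        field_simp
    _ ≤ ∫ z, (∫ x in Ici (0 : ℝ), f (x + z / 2) * conj (g (x - z / 2)) / z).im :=
        integral_mono (((hMi.div_const a).sub hindi).const_mul κ)
          hint.integral_prod_right.im hlow
    _ = _ := hswap.symm

/-! ### Construction of the counterexample -/

/-- Modulation by a positive frequency pushes the negative frequencies of a Schwartz function into
the tail of its Fourier transform. -/
theorem exists_setIntegral_fourier_modulation_le (h : 𝓢(ℝ, ℂ)) :
    ∃ C : ℝ, 0 ≤ C ∧ ∀ (ω : ℝ) (f : 𝓢(ℝ, ℂ)), 0 < ω →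
      (∀ s : ℝ, f s = Complex.exp (↑(2 * Real.pi * ω * s) * Complex.I) * h s) →
      (∫ s, ‖h s‖ ^ 2) - C / ω ^ 3 ≤ ∫ ξ in Ici 0, ‖𝓕 (f : ℝ → ℂ) ξ‖ ^ 2 := by
  set H : 𝓢(ℝ, ℂ) := 𝓕 h with hH
  obtain ⟨A, hA, hbd⟩ := H.decay 0 0
  simp only [pow_zero, norm_iteratedFDeriv_zero, one_mul] at hbd
  have hi3 : Integrable fun η => ‖η‖ ^ 3 * ‖H η‖ ^ 2 := by
    refine ((H.integrable_pow_mul volume 3).mul_const A).mono'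
      (Continuous.aestronglyMeasurable (by fun_prop)) (ae_of_all _ fun η => ?_)
    rw [Real.norm_of_nonneg (by positivity), sq, ← mul_assoc]
    exact mul_le_mul_of_nonneg_left (hbd η) (by positivity)
  -- Chebyshev with the third moment: a negative frequency of `f` lies at distance at least `ω` from
  -- the centre. The exponent must exceed `2` for the loss to be negligible against the gain of
  -- order `ω⁻²`.
  refine ⟨∫ η, ‖η‖ ^ 3 * ‖H η‖ ^ 2, integral_nonneg fun _ => by positivity,
    fun ω f hω hf => ?_⟩
  have hfour : ∀ ξ, 𝓕 (f : ℝ → ℂ) ξ = H (ξ - ω) := fun ξ => by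
    rw [hH, SchwartzMap.fourier_coe, Real.fourier_real_eq_integral_exp_smul,
      Real.fourier_real_eq_integral_exp_smul]
    congr 1
    funext s
    rw [hf, smul_eq_mul, smul_eq_mul, ← mul_assoc, ← Complex.exp_add]
    congr 2
    push_cast
    ring
  have hplanch : ∫ ξ, ‖𝓕 (f : ℝ → ℂ) ξ‖ ^ 2 = ∫ s, ‖h s‖ ^ 2 := by
    simp_rw [hfour]
    rw [integral_sub_right_eq_self (fun ξ => ‖H ξ‖ ^ 2) ω, hH, SchwartzMap.integral_norm_sq_fourier]
  have hHi : Integrable fun η => ‖H η‖ ^ 2 := by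
    refine (H.integrable.norm.mul_const A).mono'
      (Continuous.aestronglyMeasurable (by fun_prop)) (ae_of_all _ fun η => ?_)
    rw [Real.norm_of_nonneg (by positivity), sq]
    exact mul_le_mul_of_nonneg_left (hbd η) (by positivity)
  have hi : Integrable fun ξ => ‖𝓕 (f : ℝ → ℂ) ξ‖ ^ 2 := by
    simp_rw [hfour]
    exact hHi.comp_sub_right ω
  have hsplit := integral_add_compl (measurableSet_Ici (a := (0 : ℝ))) hi
  have htail : ∫ ξ in (Ici (0 : ℝ))ᶜ, ‖𝓕 (f : ℝ → ℂ) ξ‖ ^ 2 ≤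
      (∫ η, ‖η‖ ^ 3 * ‖H η‖ ^ 2) / ω ^ 3 := by
    have hi3' := (hi3.comp_sub_right ω).div_const (ω ^ 3)
    calc ∫ ξ in (Ici (0 : ℝ))ᶜ, ‖𝓕 (f : ℝ → ℂ) ξ‖ ^ 2
        ≤ ∫ ξ in (Ici (0 : ℝ))ᶜ, ‖ξ - ω‖ ^ 3 * ‖H (ξ - ω)‖ ^ 2 / ω ^ 3 := by
          refine setIntegral_mono_on hi.integrableOn hi3'.integrableOn measurableSet_Ici.compl
            fun ξ hξ => ?_
          have hξ' : ξ < 0 := not_le.1 hξ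
          have : ω ≤ ‖ξ - ω‖ := by
            rw [Real.norm_eq_abs, abs_of_neg (by linarith)]
            linarith
          rw [hfour, le_div_iff₀ (by positivity), mul_comm]
          gcongr
      _ ≤ ∫ ξ, ‖ξ - ω‖ ^ 3 * ‖H (ξ - ω)‖ ^ 2 / ω ^ 3 :=
          setIntegral_le_integral hi3' (ae_of_all _ fun ξ => by positivity)
      _ = _ := by
          rw [integral_div, integral_sub_right_eq_self (fun ξ => ‖ξ‖ ^ 3 * ‖H ξ‖ ^ 2) ω]
  linarith

theorem exists_lt_setIntegral_quadrant_wigner :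
    ∃ φ : 𝓢(ℝ, ℂ), ∫ s, ‖φ s‖ ^ 2 < ∫ p in {p : ℝ × ℝ | 0 ≤ p.1 ∧ 0 ≤ p.2}, wigner φ p := by
  let χ : ContDiffBump (2 : ℝ) := ⟨1 / 2, 1, by norm_num, by norm_num⟩
  have hχs : tsupport χ ⊆ Icc 1 3 := by
    rw [χ.tsupport_eq, Real.closedBall_eq_Icc]
    exact Icc_subset_Icc (by norm_num [χ]) (by norm_num [χ])
  have hχsm : ContDiff ℝ (⊤ : ℕ∞) χ := χ.contDiff
  have hχ2 : χ 2 ≠ 0 := (χ.pos_of_mem_ball (by simp [χ])).ne'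
  have hz0 : ∀ s, s ∉ Icc (1 : ℝ) 3 → χ s = 0 := fun s hs =>
    image_eq_zero_of_notMem_tsupport fun h => hs (hχs h)
  obtain ⟨m, C, hm, hC, hcross⟩ :=
    exists_le_im_integral_packets (χ.contDiff (n := 2)) hχs hχ2
  have hof : ContDiff ℝ (⊤ : ℕ∞) fun s : ℝ => (χ s : ℂ) := Complex.ofRealCLM.contDiff.comp hχsm
  let h : 𝓢(ℝ, ℂ) := HasCompactSupport.toSchwartzMap
    (HasCompactSupport.intro (f := fun s : ℝ => (χ s : ℂ)) (isCompact_Icc (a := 1) (b := 3))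
      fun s hs => by rw [hz0 s hs, Complex.ofReal_zero]) hof
  have hh : ∀ s, h s = χ s := fun s => rfl
  obtain ⟨D, hD, hmod⟩ := exists_setIntegral_fourier_modulation_le h
  set N := ∫ s, ‖h s‖ ^ 2 with hN
  have hNi : Integrable fun s => ‖h s‖ ^ 2 := by
    have := (h.memLp 2 volume).integrable_norm_pow (by norm_num)
    simpa using this
  have hNpos : 0 < N := by
    rw [hN, integral_pos_iff_support_of_nonneg (fun s => by positivity) hNi]
    refine IsOpen.measure_pos volume ?_ ⟨2, ?_⟩
    · have : Continuous fun s => ‖h s‖ ^ 2 := by fun_prop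
      exact this.isOpen_support
    · simp [hh, hχ2]
  -- This `k` maximizes `km/π - k²N`; the maximum is `k²N > 0`.
  set k := m / (2 * Real.pi * N) with hk
  have hkpos : 0 < k := by positivity
  obtain ⟨ω, hω, hbig⟩ : ∃ ω : ℝ, 0 < ω ∧ k * C / Real.pi + D < k ^ 2 * N * ω := by
    refine ⟨(k * C / Real.pi + D + 1) / (k ^ 2 * N), by positivity, ?_⟩
    rw [mul_div_cancel₀ _ (by positivity)]
    linarith
  have hfc : ContDiff ℝ (⊤ : ℕ∞) fun s : ℝ =>
      Complex.exp (↑(2 * Real.pi * ω * s) * Complex.I) * χ s := by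
    refine ContDiff.mul ?_ hof
    exact ContDiff.cexp (ContDiff.mul (Complex.ofRealCLM.contDiff.comp
      (contDiff_const.mul contDiff_id)) contDiff_const)
  have hgc : ContDiff ℝ (⊤ : ℕ∞) fun s : ℝ => ((k / ω : ℝ) : ℂ) *
      Complex.exp (↑(-(2 * Real.pi * ω * s)) * Complex.I) * χ (-s) := by
    refine ContDiff.mul (contDiff_const.mul ?_) (hof.comp contDiff_neg)
    exact ContDiff.cexp (ContDiff.mul (Complex.ofRealCLM.contDiff.comp
      (contDiff_const.mul contDiff_id).neg) contDiff_const)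
  let f : 𝓢(ℝ, ℂ) := HasCompactSupport.toSchwartzMap (HasCompactSupport.intro
    (isCompact_Icc (a := 1) (b := 3)) fun s hs => by
      rw [hz0 s hs, Complex.ofReal_zero, mul_zero]) hfc
  let g : 𝓢(ℝ, ℂ) := HasCompactSupport.toSchwartzMap (HasCompactSupport.intro
    (isCompact_Icc (a := -3) (b := -1)) fun s hs => by
      rw [hz0 (-s) fun h => hs ⟨by linarith [h.2], by linarith [h.1]⟩, Complex.ofReal_zero,
        mul_zero]) hgc
  have hf : ∀ s : ℝ, f s = Complex.exp (↑(2 * Real.pi * ω * s) * Complex.I) * χ s := fun s => rfl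
  have hg : ∀ s : ℝ, g s = ((k / ω : ℝ) : ℂ) *
    Complex.exp (↑(-(2 * Real.pi * ω * s)) * Complex.I) * χ (-s) := fun s => rfl
  have hf0 : ∀ s < 1, f s = 0 := fun s hs => by
    rw [hf, hz0 s fun h => by linarith [h.1], Complex.ofReal_zero, mul_zero]
  have hg0 : ∀ s > -1, g s = 0 := fun s hs => by
    rw [hg, hz0 (-s) fun h => by linarith [h.1], Complex.ofReal_zero, mul_zero]
  -- The packets have disjoint supports, so their squared norms add.
  have hnorm : ∫ s, ‖(f + g) s‖ ^ 2 = N + (k / ω) ^ 2 * N := by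
    have hpt : ∀ s, ‖(f + g) s‖ ^ 2 = ‖h s‖ ^ 2 + (k / ω) ^ 2 * ‖h (-s)‖ ^ 2 := fun s => by
      have hfn : ‖f s‖ = ‖h s‖ := by
        rw [hf, hh, norm_mul, Complex.norm_exp_ofReal_mul_I, one_mul]
      have hgn : ‖g s‖ = k / ω * ‖h (-s)‖ := by
        rw [hg, hh, norm_mul, norm_mul, Complex.norm_exp_ofReal_mul_I, mul_one, Complex.norm_real,
          Real.norm_of_nonneg (by positivity)]
      rw [FunLike.coe_add, Pi.add_apply]
      rcases le_total s 0 with hs | hs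
      · have h0 := hf0 s (by linarith)
        rw [← hfn, h0, zero_add, hgn, norm_zero]
        ring
      · have h0 := hg0 s (by linarith)
        have h1 : k / ω * ‖h (-s)‖ = 0 := by rw [← hgn, h0, norm_zero]
        rw [← mul_pow, h1, h0, add_zero, hfn]
        ring
    simp_rw [hpt]
    rw [integral_add hNi (hNi.comp_neg.const_mul _), integral_const_mul,
      integral_neg_eq_self (fun s => ‖h s‖ ^ 2)]
  refine ⟨f + g, ?_⟩
  rw [hnorm, FunLike.coe_add, setIntegral_quadrant_wigner_add f g (fun s hs => hf0 s (by linarith))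
    (fun s hs => hg0 s (by linarith)), setIntegral_quadrant_jointWigner f g hf0 hg0]
  have h1 := hmod ω f hω hf
  have h2 := hcross ω (k / ω) f g hω (by positivity) hf hg
  set Z := ∫ x in Ici (0 : ℝ), ∫ z, f (x + z / 2) * conj (g (x - z / 2)) / z with hZ
  -- The factor `1/i` turns the real part into the imaginary part of `Z`, the one governed by the
  -- sine integral.
  have hre : ((2 * Real.pi * Complex.I : ℂ)⁻¹ * Z).re = Z.im / (2 * Real.pi) := by
    rw [show (2 * Real.pi * Complex.I : ℂ)⁻¹ = (((2 * Real.pi)⁻¹ : ℝ) : ℂ) * -Complex.I by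
      rw [mul_inv, Complex.inv_I]; push_cast; ring, mul_assoc, Complex.re_ofReal_mul]
    simp
    ring
  rw [hre]
  have h3 : k / ω * (m / ω - C / ω ^ 2) / Real.pi ≤ 2 * (Z.im / (2 * Real.pi)) := by
    rw [show 2 * (Z.im / (2 * Real.pi)) = Z.im / Real.pi by field_simp]
    gcongr
  have h4 : m = k * (2 * Real.pi * N) := by
    rw [hk]
    field_simp
  have h5 : k / ω * (m / ω - C / ω ^ 2) / Real.pi - D / ω ^ 3 - (k / ω) ^ 2 * N =
      (k ^ 2 * N * ω - (k * C / Real.pi + D)) / ω ^ 3 := by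
    rw [h4]
    field_simp
    ring
  have h6 : 0 < (k ^ 2 * N * ω - (k * C / Real.pi + D)) / ω ^ 3 :=
    div_pos (by linarith) (by positivity)
  linarith

/-- The squares increase to the quarter plane, so by integrability their integrals converge and a
strict lower bound eventually holds. -/
theorem exists_one_lt_setIntegral_square {F : ℝ × ℝ → ℝ} (hF : Integrable F)
    (h : 1 < ∫ p in {p : ℝ × ℝ | 0 ≤ p.1 ∧ 0 ≤ p.2}, F p) :
    ∃ a : ℝ, 0 < a ∧
      1 < ∫ p in {p : ℝ × ℝ | (0 ≤ p.1 ∧ p.1 ≤ a) ∧ (0 ≤ p.2 ∧ p.2 ≤ a)}, F p := by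
  have hU : ⋃ a : ℝ, {p : ℝ × ℝ | (0 ≤ p.1 ∧ p.1 ≤ a) ∧ (0 ≤ p.2 ∧ p.2 ≤ a)} =
      {p : ℝ × ℝ | 0 ≤ p.1 ∧ 0 ≤ p.2} := by
    refine Subset.antisymm (iUnion_subset fun a p hp => ⟨hp.1.1, hp.2.1⟩) fun p hp => ?_
    exact mem_iUnion.2 ⟨max p.1 p.2, ⟨hp.1, le_max_left _ _⟩, ⟨hp.2, le_max_right _ _⟩⟩
  have ht := tendsto_setIntegral_of_monotone (μ := (volume : Measure (ℝ × ℝ))) (f := F)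
    (s := fun a : ℝ => {p : ℝ × ℝ | (0 ≤ p.1 ∧ p.1 ≤ a) ∧ (0 ≤ p.2 ∧ p.2 ≤ a)})
    (fun a => measurableSet_Icc.prod measurableSet_Icc)
    (fun a b hab p hp => ⟨⟨hp.1.1, hp.1.2.trans hab⟩, ⟨hp.2.1, hp.2.2.trans hab⟩⟩)
    hF.integrableOn
  rw [hU] at ht
  exact ((eventually_gt_atTop 0).and (ht.eventually (lt_mem_nhds h))).exists

theorem mainTheorem2 :
    ∃ φ₀ : 𝓢(ℝ, ℂ),
      eLpNorm φ₀ 2 volume = 1 ∧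
      1 < ∫ p in {p : ℝ × ℝ | 0 ≤ p.1 ∧ 0 ≤ p.2}, wigner φ₀ p ∧
      ∃ a : ℝ, 0 < a ∧
        1 < ∫ p in {p : ℝ × ℝ | (0 ≤ p.1 ∧ p.1 ≤ a) ∧ (0 ≤ p.2 ∧ p.2 ≤ a)}, wigner φ₀ p := by
  obtain ⟨φ, hφ⟩ := exists_lt_setIntegral_quadrant_wigner
  have hcont : Continuous fun s => ‖φ s‖ ^ 2 := by fun_prop
  have hi : Integrable fun s => ‖φ s‖ ^ 2 := by
    simpa using (φ.memLp 2 volume).integrable_norm_pow (by norm_num)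
  set N := ∫ s, ‖φ s‖ ^ 2 with hN
  -- If `N = 0` then `φ = 0`, and the strict inequality `hφ` would read `0 < 0`.
  have hNpos : 0 < N := by
    refine (integral_nonneg fun s => by positivity).lt_of_ne' fun h0 => ?_
    have hz : (fun s => ‖φ s‖ ^ 2) = 0 :=
      hcont.ae_eq_iff_eq volume continuous_zero |>.1
        ((integral_eq_zero_iff_of_nonneg (fun s => by positivity) hi).1 h0)
    have hφ0 : (φ : ℝ → ℂ) = 0 := funext fun s => by simpa using congrFun hz s
    rw [hN, h0, hφ0] at hφ
    simp [wigner, jointWigner] at hφ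
  set c : ℂ := (((Real.sqrt N)⁻¹ : ℝ) : ℂ) with hc
  have hcn : ‖c‖ ^ 2 = N⁻¹ := by
    rw [hc, Complex.norm_real, Real.norm_of_nonneg (by positivity), inv_pow, Real.sq_sqrt hNpos.le]
  have hW : ∀ p, wigner (c • φ : 𝓢(ℝ, ℂ)) p = N⁻¹ * wigner φ p := fun p => by
    rw [FunLike.coe_smul, wigner_smul, hcn]
  have hquad : 1 < ∫ p in {p : ℝ × ℝ | 0 ≤ p.1 ∧ 0 ≤ p.2}, wigner (c • φ : 𝓢(ℝ, ℂ)) p := by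
    simp_rw [hW]
    rw [integral_const_mul, inv_mul_eq_div, one_lt_div hNpos]
    exact hφ
  refine ⟨c • φ, ?_, hquad, exists_one_lt_setIntegral_square (integrable_wigner _) hquad⟩
  rw [((c • φ).memLp 2 volume).eLpNorm_eq_integral_rpow_norm (by norm_num) (by norm_num)]
  have hone : ∫ s, ‖(c • φ) s‖ ^ 2 = 1 := by
    simp_rw [FunLike.coe_smul, Pi.smul_apply, norm_smul, mul_pow, hcn]
    rw [integral_const_mul, ← hN, inv_mul_cancel₀ hNpos.ne']
  simp only [ENNReal.toReal_ofNat, Real.rpow_ofNat, hone, Real.one_rpow, ENNReal.ofReal_one]
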